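/- Let $r\ge 1$ and $n\ge 1$ be integers, and let $V$ be a complex vector space with basis $v_1,\dots,v_n$. Let $A_r(n)$ be the partition algebra over $\mathbb{C}$ with parameter $n$: it has as basis the set partitions of $\{1,\dots,r,1',\dots,r'\}$ (drawn as diagrams with top row $1,\dots,r$ and bottom row $1',\dots,r'$), with product $\rho_1\rho_2=n^{\ell}\,\rho_1\circ\rho_2$, where $\rho_1\circ\rho_2$ is obtained by placing $\rho_1$ above $\rho_2$, identifying the bottom row of $\rho_1$ with the top row of $\rho_2$ and deleting the $\ell$ components that lie entirely in the middle row. In each of the following elements, every pair $\{a,a'\}$ not mentioned is a block: $s_i$ has the blocks $\{i,(i+1)'\},\{i+1,i'\}$; $p_{i+\frac12}$ has the block $\{i,i+1,i',(i+1)'\}$ (both for $1\le i<r$); $p_i$ has the blocks $\{i\},\{i'\}$ (for $1\le i\le r$). Define $L_0=0$, $L_1=p_1$, $\sigma_1=1$, $\sigma_2=s_1$ and \[ L_{i+1}=-s_iL_ip_{i+\frac12}-p_{i+\frac12}L_is_i+p_{i+\frac12}L_ip_{i+1}p_{i+\frac12}+s_iL_is_i+\sigma_{i+1}\qquad(i\ge1),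 \] \[ \begin{aligned} \sigma_{i+1}={}&s_{i-1}s_i\sigma_is_is_{i-1}+s_ip_{i-\frac12}L_{i-1}s_ip_{i-\frac12}s_i+p_{i-\frac12}L_{i-1}s_ip_{i-\frac12}\\ &-s_ip_{i-\frac12}L_{i-1}s_{i-1}p_{i+\frac12}p_ip_{i-\frac12}-p_{i-\frac12}p_ip_{i+\frac12}s_{i-1}L_{i-1}p_{i-\frac12}s_i\qquad(i\ge2), \end{aligned} \] and define $L_{\frac12}=0$, $\sigma_{1+\frac12}=1$ and \[ L_{i+\frac12}=-L_ip_{i+\frac12}-p_{i+\frac12}L_i+p_{i+\frac12}L_ip_ip_{i+\frac12}+s_iL_{i-\frac12}s_i+\sigma_{i+\frac12}\qquad(i\ge1), \] \[ \begin{aligned} \sigma_{i+\frac12}={}&s_{i-1}s_i\sigma_{i-\frac12}s_is_{i-1}+p_{i-\frac12}L_{i-1}s_ip_{i-\frac12}s_i+s_ip_{i-\frac12}L_{i-1}s_ip_{i-\frac12}\\ &-p_{i-\frac12}L_{i-1}s_{i-1}p_{i+\frac12}p_ip_{i-\frac12}-s_ip_{i-\frac12}p_ip_{i+\frac12}s_{i-1}L_{i-1}p_{i-\frac12}s_i\qquad(i\ge2).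 \end{aligned} \] Put $z_{r}=L_{\frac12}+L_1+L_{1+\frac12}+\cdots+L_{r-\frac12}+L_{r}$ and $z_{r-\frac12}=L_{\frac12}+L_1+L_{1+\frac12}+\cdots+L_{r-1}+L_{r-\frac12}$ in $A_r(n)$. The algebra $A_r(n)$ acts on $V^{\otimes r}$: a diagram $d$ sends $v_{i_1}\otimes\cdots\otimes v_{i_r}$ to the sum of all $v_{j_1}\otimes\cdots\otimes v_{j_r}$ such that labelling the top vertices by $j_1,\dots,j_r$ and the bottom vertices by $i_1,\dots,i_r$ gives a labelling that is constant on each block of $d$. Thus $s_k$ interchanges the $k$-th and $(k+1)$-st tensor factors, $p_{k+\frac12}$ fixes $v_{i_1}\otimes\cdots\otimes v_{i_r}$ if $i_k=i_{k+1}$ and sends it to $0$ otherwise, and $p_k$ replaces the $k$-th factor by $\sum_{j=1}^n v_j$. The symmetric group $\mathfrak S_n$ permutes $v_1,\dots,v_n$ and acts diagonally on $V^{\otimes r}$; this extends linearly to $\mathbb{C}\mathfrak S_n$. With $s_{i,j}\in\mathfrak S_n$ the transposition of $i$ and $j$, put \[ \kappa_n=\sum_{1\le i<j\le n}s_{i,j},\qquad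 \kappa_{n,l}=\sum_{\substack{1\le i<j\le n\\ i,j\ne l}}s_{i,j}\qquad(1\le l\le n) \] in $\mathbb{C}\mathfrak S_n$. Then for all $1\le i_1,\dots,i_r\le n$, \[ z_r(v_{i_1}\otimes\cdots\otimes v_{i_r})=\kappa_n(v_{i_1}\otimes\cdots\otimes v_{i_r})-\Big(\tbinom n2-rn\Big)(v_{i_1}\otimes\cdots\otimes v_{i_r}), \] and, if $r\ge2$, \[ z_{r-\frac12}(v_{i_1}\otimes\cdots\otimes v_{i_r})=\kappa_{n,i_r}(v_{i_1}\otimes\cdots\otimes v_{i_r})-\Big(\tbinom n2-rn+1\Big)(v_{i_1}\otimes\cdots\otimes v_{i_r}). \] -/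

import Mathlib

open scoped TensorProduct BigOperators

/-- A partition diagram with `k` vertices in each row: a set partition of the top row `1, …, k`
(the left summand) together with the bottom row `1', …, k'` (the right summand). -/
abbrev PartitionDiagram (k : ℕ) : Type := Setoid (Fin k ⊕ Fin k)

namespace PartitionDiagram

variable {k : ℕ}

/-- The top and bottom rows of the upper diagram, as the top and middle rows of three rows. -/
def upper : Fin k ⊕ Fin k → Fin k ⊕ (Fin k ⊕ Fin k) := Sum.map id Sum.inl

/-- The top and bottom rows of the lower diagram, as the middle and bottom rows of three rows. -/
def lower : Fin k ⊕ Fin k → Fin k ⊕ (Fin k ⊕ Fin k) := Sum.inr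

/-- The top and bottom rows of three rows. -/
def outer : Fin k ⊕ Fin k → Fin k ⊕ (Fin k ⊕ Fin k) := Sum.map id Sum.inr

/-- The partition of three rows into the connected components obtained by placing `d` above `e`
and identifying the bottom row of `d` with the top row of `e`. -/
def stack (d e : PartitionDiagram k) : Setoid (Fin k ⊕ (Fin k ⊕ Fin k)) :=
  d.map upper ⊔ e.map lower

/-- The composition `d ∘ e`: place `d` above `e` and forget the middle row. -/
@[reducible]
def comp (d e : PartitionDiagram k) : PartitionDiagram k := (stack d e).comap outer

/-- A component of the stacked diagram that contains only vertices of the middle row. -/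
def IsInner (d e : PartitionDiagram k) (c : Quotient (stack d e)) : Prop :=
  ∀ x, Quotient.mk (stack d e) x = c → ∃ j : Fin k, x = Sum.inr (Sum.inl j)

/-- The number of blocks removed from the middle row in forming `d ∘ e`. -/
noncomputable def loops (d e : PartitionDiagram k) : ℕ := Nat.card {c // IsInner d e c}

/-- The identity diagram, with blocks `{a, a'}`. -/
@[reducible]
def idDiagram (k : ℕ) : PartitionDiagram k := Setoid.ker (Sum.elim id id)

/-- The diagram of `s_i` (for `1 ≤ i < k`, vertices numbered from `1`): vertex `i` is joined
to `(i+1)'`, vertex `i+1` to `i'`, and `a` to `a'` for the other vertices. -/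
@[reducible]
def sDiagram (k i : ℕ) : PartitionDiagram k :=
  Setoid.ker (Sum.elim (fun a : Fin k => Equiv.swap i (i + 1) (a.val + 1))
    (fun a : Fin k => a.val + 1))

/-- The diagram of `p_i` (for `1 ≤ i ≤ k`): the blocks are `{i}`, `{i'}`, and `{a, a'}` for
`a ≠ i`. -/
@[reducible]
def pDiagram (k i : ℕ) : PartitionDiagram k :=
  Setoid.ker (Sum.elim (fun a : Fin k => (a.val + 1, decide (a.val + 1 = i)))
    (fun a : Fin k => (a.val + 1, false)))

/-- The diagram of `p_{i+1/2}` (for `1 ≤ i < k`): the blocks are `{i, i+1, i', (i+1)'}`, and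
`{a, a'}` for `a ≠ i, i+1`. -/
@[reducible]
def pHalfDiagram (k i : ℕ) : PartitionDiagram k :=
  Setoid.ker (fun x : Fin k ⊕ Fin k =>
    if (Sum.elim id id x).val + 1 = i + 1 then i else (Sum.elim id id x).val + 1)

/-- The labelling of the two rows by `a` and `b` is constant on the blocks of `d`. -/
def Fits {n : ℕ} (d : PartitionDiagram k) (a b : Fin k → Fin n) : Prop :=
  d ≤ Setoid.ker (Sum.elim a b)

theorem stack_le_ker {n : ℕ} (d e : PartitionDiagram k) (a m b : Fin k → Fin n) :
    stack d e ≤ Setoid.ker (Sum.elim a (Sum.elim m b)) ↔ Fits d a m ∧ Fits e m b := by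
  have key : ∀ (f : Fin k ⊕ Fin k → Fin k ⊕ (Fin k ⊕ Fin k)) (c : PartitionDiagram k)
      (g : Fin k ⊕ (Fin k ⊕ Fin k) → Fin n),
      c.map f ≤ Setoid.ker g ↔ c ≤ Setoid.ker (g ∘ f) := by
    intro f c g
    constructor
    · intro h x y hxy
      exact h (Relation.EqvGen.rel _ _ ⟨x, y, hxy, rfl, rfl⟩)
    · intro h
      refine Setoid.eqvGen_le ?_
      rintro x y ⟨a, b, hab, rfl, rfl⟩
      exact h hab
  unfold stack Fits
  rw [sup_le_iff, key, key]
  have h1 : Sum.elim a (Sum.elim m b) ∘ upper = Sum.elim a m := by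
    funext x; cases x <;> rfl
  have h2 : Sum.elim a (Sum.elim m b) ∘ lower = Sum.elim m b := by
    funext x; cases x <;> rfl
  rw [h1, h2]

theorem card_fits {n : ℕ} (d e : PartitionDiagram k) (a b : Fin k → Fin n)
    (h : Fits (comp d e) a b) :
    Nat.card {m : Fin k → Fin n // Fits d a m ∧ Fits e m b} = n ^ loops d e := by
  classical
  let F : {m : Fin k → Fin n // Fits d a m ∧ Fits e m b} → ({c // IsInner d e c} → Fin n) :=
    fun m c => Quotient.lift (Sum.elim a (Sum.elim m.1 b))
      (fun _ _ hxy => (stack_le_ker d e a m.1 b).2 m.2 hxy) c.1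
  have hout : ∀ c : Quotient (stack d e), ¬ IsInner d e c →
      ∃ x, Quotient.mk (stack d e) (outer x) = c := by
    intro c hc
    unfold IsInner at hc
    push Not at hc
    obtain ⟨x, hx, hx'⟩ := hc
    rcases x with x | x | x
    · exact ⟨Sum.inl x, hx⟩
    · exact absurd rfl (hx' x)
    · exact ⟨Sum.inr x, hx⟩
  have hlab : ∀ m : Fin k → Fin n, ∀ x, Sum.elim a (Sum.elim m b) (outer x) = Sum.elim a b x := by
    intro m x; cases x <;> rfl
  have hF : Function.Bijective F := by
    constructor
    · intro m m' hmm
      apply Subtype.ext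
      funext j
      by_cases hc : IsInner d e (Quotient.mk _ (Sum.inr (Sum.inl j)))
      · exact congrFun hmm ⟨_, hc⟩
      · obtain ⟨x, hx⟩ := hout _ hc
        have hx := Quotient.exact hx
        have h1 := (stack_le_ker d e a m.1 b).2 m.2 hx
        have h2 := (stack_le_ker d e a m'.1 b).2 m'.2 hx
        rw [Setoid.ker_def, hlab] at h1 h2
        exact h1.symm.trans h2
    · intro g
      let G : Quotient (stack d e) → Fin n := fun c =>
        if hc : IsInner d e c then g ⟨c, hc⟩ else Sum.elim a b (Classical.choose (hout c hc))
      have hG : ∀ x, G (Quotient.mk _ (outer x)) = Sum.elim a b x := by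
        intro x
        have hc : ¬ IsInner d e (Quotient.mk _ (outer x)) := by
          intro hc
          obtain ⟨j, hj⟩ := hc _ rfl
          cases x <;> simp [outer] at hj
        simp only [G, dif_neg hc]
        exact h (show stack d e _ _ from Quotient.exact (Classical.choose_spec (hout _ hc)))
      let m : Fin k → Fin n := fun j => G (Quotient.mk _ (Sum.inr (Sum.inl j)))
      have hm : ∀ x, Sum.elim a (Sum.elim m b) x = G (Quotient.mk _ x) := by
        rintro (x | x | x)
        · exact (hG (Sum.inl x)).symm
        · rfl
        · exact (hG (Sum.inr x)).symm
      refine ⟨⟨m, (stack_le_ker d e a m b).1 ?_⟩, ?_⟩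
      · intro x y hxy
        rw [Setoid.ker_def, hm, hm]
        exact congrArg G (Quotient.sound hxy)
      · funext c
        obtain ⟨c, hc⟩ := c
        induction c using Quotient.inductionOn with
        | h x =>
          change Sum.elim a (Sum.elim m b) x = _
          rw [hm]
          simp only [G, dif_pos hc]
  rw [Nat.card_eq_of_bijective F hF, Nat.card_fun, Nat.card_fin, loops]

open Classical in
/-- The matrix entry of `d` in the action on tensor space. -/
noncomputable def entry {n : ℕ} (d : PartitionDiagram k) (a b : Fin k → Fin n) : ℕ :=
  if Fits d a b then 1 else 0

theorem sum_entry_mul {n : ℕ} (d e : PartitionDiagram k) (a b : Fin k → Fin n) :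
    ∑ m : Fin k → Fin n, entry d a m * entry e m b = n ^ loops d e * entry (comp d e) a b := by
  classical
  have h1 : ∀ m : Fin k → Fin n,
      entry d a m * entry e m b = if Fits d a m ∧ Fits e m b then 1 else 0 := by
    intro m
    unfold entry
    by_cases h : Fits d a m <;> by_cases h' : Fits e m b <;> simp [h, h']
  rw [Finset.sum_congr rfl fun m _ => h1 m, ← Finset.card_filter]
  by_cases h : Fits (comp d e) a b
  · rw [← card_fits d e a b h, entry, if_pos h, mul_one, Nat.card_eq_fintype_card,
      Fintype.card_subtype]
  · rw [entry, if_neg h, mul_zero, Finset.card_eq_zero, Finset.filter_eq_empty_iff]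
    intro m _ hm
    refine h fun x y hxy => ?_
    have := (stack_le_ker d e a m b).2 hm hxy
    rw [Setoid.ker_def] at this ⊢
    cases x <;> cases y <;> exact this

theorem entry_idDiagram {n : ℕ} (a b : Fin k → Fin n) :
    entry (idDiagram k) a b = if a = b then 1 else 0 := by
  classical
  have : Fits (idDiagram k) a b ↔ a = b := by
    constructor
    · intro h
      funext j
      exact h (x := Sum.inl j) (y := Sum.inr j) rfl
    · rintro rfl x y hxy
      cases x <;> cases y <;> exact congrArg a hxy
  unfold entry
  simp only [this]

theorem entry_const {n : ℕ} (d : PartitionDiagram k) (c : Fin n) :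
    entry d (fun _ => c) (fun _ => c) = 1 := by
  unfold entry
  rw [if_pos]
  intro x y _
  cases x <;> cases y <;> rfl

theorem entry_injective {d e : PartitionDiagram k} {p q : ℕ}
    (h : ∀ a b : Fin k → Fin 2, 2 ^ p * entry d a b = 2 ^ q * entry e a b) :
    p = q ∧ d = e := by
  classical
  have h0 := h (fun _ => 0) (fun _ => 0)
  rw [entry_const, entry_const, mul_one, mul_one] at h0
  have hpq := Nat.pow_right_injective le_rfl h0
  refine ⟨hpq, ?_⟩
  have h2 : ∀ a b : Fin k → Fin 2, Fits d a b ↔ Fits e a b := by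
    intro a b
    have := h a b
    rw [hpq] at this
    have := Nat.eq_of_mul_eq_mul_left (by positivity) this
    unfold entry at this
    by_cases h1 : Fits d a b <;> by_cases h3 : Fits e a b <;> simp_all
  have key : ∀ d e : PartitionDiagram k, (∀ a b : Fin k → Fin 2, Fits d a b ↔ Fits e a b) →
      d ≤ e := by
    intro d e h2 x y hxy
    let f : Fin k ⊕ Fin k → Fin 2 := fun z => if e x z then 1 else 0
    have hf : Sum.elim (f ∘ Sum.inl) (f ∘ Sum.inr) = f := by
      funext z; cases z <;> rfl
    have he : Fits e (f ∘ Sum.inl) (f ∘ Sum.inr) := by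
      unfold Fits
      rw [hf]
      intro z w hzw
      have : e x z ↔ e x w := ⟨fun h => e.trans h hzw, fun h => e.trans h (e.symm hzw)⟩
      rw [Setoid.ker_def]
      simp only [f, this]
    have hd := (h2 _ _).2 he
    unfold Fits at hd
    rw [hf] at hd
    have := hd hxy
    rw [Setoid.ker_def] at this
    by_contra hne
    simp [f, hne] at this
  exact le_antisymm (key d e h2) (key e d fun a b => (h2 a b).symm)

theorem comp_assoc_loops (d e f : PartitionDiagram k) :
    loops d e + loops (comp d e) f = loops e f + loops d (comp e f) ∧
      comp (comp d e) f = comp d (comp e f) := by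
  refine entry_injective fun a b => ?_
  rw [pow_add, pow_add, mul_assoc, mul_assoc, ← sum_entry_mul, ← sum_entry_mul, Finset.mul_sum,
    Finset.mul_sum]
  simp_rw [← mul_assoc, mul_right_comm _ (entry d a _), mul_comm (_ * entry (comp e f) _ b),
    ← sum_entry_mul, Finset.sum_mul, Finset.mul_sum]
  rw [Finset.sum_comm]
  simp only [mul_assoc]

theorem idDiagram_comp (d : PartitionDiagram k) :
    loops (idDiagram k) d = 0 ∧ comp (idDiagram k) d = d := by
  refine entry_injective fun a b => ?_
  rw [← sum_entry_mul]
  simp [entry_idDiagram]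

theorem comp_idDiagram (d : PartitionDiagram k) :
    loops d (idDiagram k) = 0 ∧ comp d (idDiagram k) = d := by
  refine entry_injective fun a b => ?_
  rw [← sum_entry_mul]
  simp [entry_idDiagram]

end PartitionDiagram

open PartitionDiagram

/-- The partition algebra on `k` strands over `R` with parameter `δ`: the free `R`-module on the
partition diagrams, with product `d * e = δ ^ ℓ • (d ∘ e)`, where `ℓ` is the number of blocks
removed from the middle row. -/
def PartitionAlgebra (R : Type*) [CommRing R] (_δ : R) (k : ℕ) : Type _ := PartitionDiagram k →₀ R

namespace PartitionAlgebra

section Ring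

variable {R : Type*} [CommRing R] {δ : R} {k : ℕ}

noncomputable instance : AddCommGroup (PartitionAlgebra R δ k) :=
  inferInstanceAs (AddCommGroup (PartitionDiagram k →₀ R))

noncomputable instance : Module R (PartitionAlgebra R δ k) :=
  inferInstanceAs (Module R (PartitionDiagram k →₀ R))

/-- The basis element of the partition algebra given by a diagram. -/
noncomputable def ofDiagram (δ : R) (d : PartitionDiagram k) : PartitionAlgebra R δ k :=
  Finsupp.single d (1 : R)

/-- The linear extension of a function on diagrams. -/
noncomputable def extend {M : Type*} [AddCommGroup M] [Module R M] (f : PartitionDiagram k → M) :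
    PartitionAlgebra R δ k →ₗ[R] M :=
  Finsupp.linearCombination R f

@[simp]
theorem extend_ofDiagram {M : Type*} [AddCommGroup M] [Module R M] (f : PartitionDiagram k → M)
    (d : PartitionDiagram k) : extend f (ofDiagram δ d) = f d := by
  exact (Finsupp.linearCombination_single R (1 : R) d).trans (one_smul R (f d))

theorem hom_ext {M : Type*} [AddCommGroup M] [Module R M] {f g : PartitionAlgebra R δ k →ₗ[R] M}
    (h : ∀ d, f (ofDiagram δ d) = g (ofDiagram δ d)) : f = g :=
  Finsupp.lhom_ext' fun d => LinearMap.ext_ring (h d)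

/-- The multiplication, as a bilinear map. -/
noncomputable def mulMap :
    PartitionAlgebra R δ k →ₗ[R] PartitionAlgebra R δ k →ₗ[R] PartitionAlgebra R δ k :=
  extend fun d => extend fun e => δ ^ loops d e • ofDiagram δ (comp d e)

noncomputable instance : Mul (PartitionAlgebra R δ k) := ⟨fun x y => mulMap x y⟩

noncomputable instance : One (PartitionAlgebra R δ k) := ⟨ofDiagram δ (idDiagram k)⟩

theorem mul_def (x y : PartitionAlgebra R δ k) : x * y = mulMap x y := rfl

theorem one_def : (1 : PartitionAlgebra R δ k) = ofDiagram δ (idDiagram k) := rfl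

theorem ofDiagram_mul (d e : PartitionDiagram k) :
    ofDiagram δ d * ofDiagram δ e = δ ^ loops d e • ofDiagram δ (comp d e) := by
  simp [mul_def, mulMap]

theorem mul_assoc_aux (x y w : PartitionAlgebra R δ k) : x * y * w = x * (y * w) := by
  have h1 : ∀ d e : PartitionDiagram k, mulMap (mulMap (ofDiagram δ d) (ofDiagram δ e)) =
      mulMap (ofDiagram δ d) ∘ₗ mulMap (ofDiagram δ e) := by
    intro d e
    refine hom_ext fun f => ?_
    obtain ⟨h, h'⟩ := comp_assoc_loops d e f
    simp [mulMap, smul_smul, ← pow_add, h, h']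
  have h2 : ∀ d : PartitionDiagram k, mulMap.flip w ∘ₗ mulMap (ofDiagram δ d) =
      mulMap (ofDiagram δ d) ∘ₗ mulMap.flip w := fun d =>
    hom_ext fun e => LinearMap.congr_fun (h1 d e) w
  have h3 : mulMap.flip w ∘ₗ mulMap.flip y = mulMap.flip (mulMap y w) :=
    hom_ext fun d => LinearMap.congr_fun (h2 d) y
  exact LinearMap.congr_fun h3 x

noncomputable instance : Ring (PartitionAlgebra R δ k) :=
  { (inferInstance : AddCommGroup (PartitionAlgebra R δ k)) with
    mul := (· * ·)
    one := 1
    left_distrib := fun x y w => map_add (mulMap x) y w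
    right_distrib := fun x y w => LinearMap.congr_fun (map_add mulMap x y) w
    zero_mul := fun x => LinearMap.congr_fun (map_zero mulMap) x
    mul_zero := fun x => map_zero (mulMap x)
    mul_assoc := mul_assoc_aux
    one_mul := fun x => by
      have h : mulMap (1 : PartitionAlgebra R δ k) = LinearMap.id := by
        refine hom_ext fun d => ?_
        obtain ⟨h, h'⟩ := idDiagram_comp d
        simp [one_def, mulMap, h, h']
      exact LinearMap.congr_fun h x
    mul_one := fun x => by
      have h : mulMap.flip (1 : PartitionAlgebra R δ k) = LinearMap.id := by
        refine hom_ext fun d => ?_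
        obtain ⟨h, h'⟩ := comp_idDiagram d
        simp [one_def, mulMap, h, h']
      exact LinearMap.congr_fun h x }

noncomputable instance : Algebra R (PartitionAlgebra R δ k) :=
  Algebra.ofModule (fun c x y => LinearMap.congr_fun (map_smul mulMap c x) y)
    (fun c x y => map_smul (mulMap x) c y)

end Ring

section JucysMurphy

variable {R : Type*} [CommRing R] (δ : R) (k : ℕ)

/-- The element `s_i`, for `1 ≤ i < k`. -/
noncomputable def s (i : ℕ) : PartitionAlgebra R δ k := ofDiagram δ (sDiagram k i)

/-- The element `p_i`, for `1 ≤ i ≤ k`. -/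
noncomputable def p (i : ℕ) : PartitionAlgebra R δ k := ofDiagram δ (pDiagram k i)

/-- The element `p_{i+1/2}`, for `1 ≤ i < k`. -/
noncomputable def pHalf (i : ℕ) : PartitionAlgebra R δ k := ofDiagram δ (pHalfDiagram k i)

mutual

/-- The element `σ_i` of the partition algebra on `k` strands, for `1 ≤ i ≤ k`. -/
noncomputable def sigma : ℕ → PartitionAlgebra R δ k
  | 0 => 0
  | 1 => 1
  | 2 => s δ k 1
  | i + 3 =>
      s δ k (i + 1) * s δ k (i + 2) * sigma (i + 2) * s δ k (i + 2) * s δ k (i + 1)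
      + s δ k (i + 2) * pHalf δ k (i + 1) * L (i + 1) * s δ k (i + 2) * pHalf δ k (i + 1)
          * s δ k (i + 2)
      + pHalf δ k (i + 1) * L (i + 1) * s δ k (i + 2) * pHalf δ k (i + 1)
      - s δ k (i + 2) * pHalf δ k (i + 1) * L (i + 1) * s δ k (i + 1) * pHalf δ k (i + 2)
          * p δ k (i + 2) * pHalf δ k (i + 1)
      - pHalf δ k (i + 1) * p δ k (i + 2) * pHalf δ k (i + 2) * s δ k (i + 1) * L (i + 1)
          * pHalf δ k (i + 1) * s δ k (i + 2)
  termination_by i => (i, 0)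

/-- The Jucys–Murphy element `L_i` of the partition algebra on `k` strands, for `0 ≤ i ≤ k`. -/
noncomputable def L : ℕ → PartitionAlgebra R δ k
  | 0 => 0
  | 1 => p δ k 1
  | i + 2 =>
      - s δ k (i + 1) * L (i + 1) * pHalf δ k (i + 1)
      - pHalf δ k (i + 1) * L (i + 1) * s δ k (i + 1)
      + pHalf δ k (i + 1) * L (i + 1) * p δ k (i + 2) * pHalf δ k (i + 1)
      + s δ k (i + 1) * L (i + 1) * s δ k (i + 1)
      + sigma (i + 2)
  termination_by i => (i, 1)

end

/-- The element `σ_{i+1/2}` of the partition algebra on `k` strands, for `0 ≤ i < k`. -/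
noncomputable def sigmaHalf : ℕ → PartitionAlgebra R δ k
  | 0 => 1
  | 1 => 1
  | i + 2 =>
      s δ k (i + 1) * s δ k (i + 2) * sigmaHalf (i + 1) * s δ k (i + 2) * s δ k (i + 1)
      + pHalf δ k (i + 1) * L δ k (i + 1) * s δ k (i + 2) * pHalf δ k (i + 1) * s δ k (i + 2)
      + s δ k (i + 2) * pHalf δ k (i + 1) * L δ k (i + 1) * s δ k (i + 2) * pHalf δ k (i + 1)
      - pHalf δ k (i + 1) * L δ k (i + 1) * s δ k (i + 1) * pHalf δ k (i + 2) * p δ k (i + 2)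
          * pHalf δ k (i + 1)
      - s δ k (i + 2) * pHalf δ k (i + 1) * p δ k (i + 2) * pHalf δ k (i + 2) * s δ k (i + 1)
          * L δ k (i + 1) * pHalf δ k (i + 1) * s δ k (i + 2)

/-- The Jucys–Murphy element `L_{i+1/2}` of the partition algebra on `k` strands, for
`0 ≤ i < k`. -/
noncomputable def LHalf : ℕ → PartitionAlgebra R δ k
  | 0 => 0
  | i + 1 =>
      - L δ k (i + 1) * pHalf δ k (i + 1)
      - pHalf δ k (i + 1) * L δ k (i + 1)
      + pHalf δ k (i + 1) * L δ k (i + 1) * p δ k (i + 1) * pHalf δ k (i + 1)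
      + s δ k (i + 1) * LHalf i * s δ k (i + 1)
      + sigmaHalf δ k (i + 1)

/-- The element `z_m = L_{1/2} + L_1 + L_{1+1/2} + ⋯ + L_m`, in the partition algebra on `k`
strands, for `m ≤ k`. -/
noncomputable def z (m : ℕ) : PartitionAlgebra R δ k :=
  ∑ i ∈ Finset.range m, (LHalf δ k i + L δ k (i + 1))

/-- The element `z_{m+1/2} = L_{1/2} + L_1 + L_{1+1/2} + ⋯ + L_m + L_{m+1/2}`, in the partition
algebra on `k` strands, for `m < k`. -/
noncomputable def zHalf (m : ℕ) : PartitionAlgebra R δ k := z δ k m + LHalf δ k m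

end JucysMurphy

section Action

variable {n r : ℕ} {V : Type*} [AddCommGroup V] [Module ℂ V] (v : Module.Basis (Fin n) ℂ V)

open Classical in
/-- The operator of a diagram on `V^{⊗ r}`: it sends `v_{i_1} ⊗ ⋯ ⊗ v_{i_r}` to the sum of the
`v_{j_1} ⊗ ⋯ ⊗ v_{j_r}` for which the labels `j_1, …, j_r` of the top row and `i_1, …, i_r` of the
bottom row are constant on the blocks of the diagram. -/
noncomputable def diagramAction (d : PartitionDiagram r) :
    Module.End ℂ (⨂[ℂ] _ : Fin r, V) :=
  (Basis.piTensorProduct fun _ : Fin r => v).constr ℂ fun i =>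
    ∑ j : Fin r → Fin n, if Fits d j i then ⨂ₜ[ℂ] a, v (j a) else 0

theorem diagramAction_tprod (d : PartitionDiagram r) (i : Fin r → Fin n) :
    diagramAction v d (⨂ₜ[ℂ] a, v (i a)) =
      ∑ j : Fin r → Fin n, (entry d j i : ℂ) • ⨂ₜ[ℂ] a, v (j a) := by
  classical
  rw [← Basis.piTensorProduct_apply, diagramAction, Module.Basis.constr_basis]
  refine Finset.sum_congr rfl fun j _ => ?_
  unfold entry
  split_ifs <;> simp

theorem diagramAction_one : diagramAction v (idDiagram r) = 1 := by
  refine (Basis.piTensorProduct fun _ : Fin r => v).ext fun i => ?_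
  rw [Basis.piTensorProduct_apply, diagramAction_tprod]
  simp [entry_idDiagram]

theorem diagramAction_mul (d e : PartitionDiagram r) :
    diagramAction v d * diagramAction v e = (n : ℂ) ^ loops d e • diagramAction v (comp d e) := by
  refine (Basis.piTensorProduct fun _ : Fin r => v).ext fun i => ?_
  rw [Basis.piTensorProduct_apply, Module.End.mul_apply, LinearMap.smul_apply]
  simp only [diagramAction_tprod, map_sum, map_smul, Finset.smul_sum, smul_smul]
  rw [Finset.sum_comm]
  refine Finset.sum_congr rfl fun j _ => ?_
  rw [← Finset.sum_smul]
  congr 1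
  have := sum_entry_mul d e j i
  rw [← Nat.cast_pow, ← Nat.cast_mul, ← this, Nat.cast_sum]
  exact Finset.sum_congr rfl fun m _ => by rw [mul_comm, Nat.cast_mul]

/-- The action of the partition algebra `A_r(n)`, the partition algebra over `ℂ` with parameter
`n`, on `V^{⊗ r}`, where `V` has basis `v_1, …, v_n`. -/
noncomputable def tensorAction :
    PartitionAlgebra ℂ (n : ℂ) r →ₐ[ℂ] Module.End ℂ (⨂[ℂ] _ : Fin r, V) :=
  AlgHom.ofLinearMap (extend (diagramAction v))
    (by rw [one_def, extend_ofDiagram, diagramAction_one])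
    (by
      intro x y
      let E := extend (δ := (n : ℂ)) (diagramAction (r := r) v)
      have h1 : ∀ d : PartitionDiagram r, E ∘ₗ mulMap (ofDiagram (n : ℂ) d) =
          LinearMap.mulLeft ℂ (diagramAction v d) ∘ₗ E := by
        intro d
        refine hom_ext fun e => ?_
        simp [E, mulMap, diagramAction_mul]
      have h2 : E ∘ₗ mulMap.flip y = LinearMap.mulRight ℂ (E y) ∘ₗ E := by
        refine hom_ext fun d => (LinearMap.congr_fun (h1 d) y).trans ?_
        simp [E]
      exact LinearMap.congr_fun h2 x)

end Action

end PartitionAlgebra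

section SymmetricGroup

variable {n : ℕ} {V : Type*} [AddCommGroup V] [Module ℂ V] (v : Module.Basis (Fin n) ℂ V)

/-- The permutation representation of the symmetric group: `w` sends `v_i` to `v_{w(i)}`. -/
noncomputable def permRep : Representation ℂ (Equiv.Perm (Fin n)) V where
  toFun w := v.constr ℂ fun i => v (w i)
  map_one' := v.ext fun i => by simp
  map_mul' w w' := v.ext fun i => by simp

/-- The diagonal representation of the symmetric group on `V^{⊗ r}`. -/
noncomputable def diagonalRep (r : ℕ) :
    Representation ℂ (Equiv.Perm (Fin n)) (⨂[ℂ] _ : Fin r, V) where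
  toFun w := PiTensorProduct.map fun _ => permRep v w
  map_one' := by simp [PiTensorProduct.map_one]
  map_mul' w w' := by simp [PiTensorProduct.map_mul]

/-- The class sum `κ_n` of the transpositions in the group algebra of the symmetric group. -/
noncomputable def kappa (n : ℕ) : MonoidAlgebra ℂ (Equiv.Perm (Fin n)) :=
  ∑ q : Fin n × Fin n with q.1 < q.2, MonoidAlgebra.single (Equiv.swap q.1 q.2) (1 : ℂ)

/-- The sum `κ_{n,l}` of the transpositions that fix `l`. -/
noncomputable def kappaFix (n : ℕ) (l : Fin n) : MonoidAlgebra ℂ (Equiv.Perm (Fin n)) :=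
  ∑ q : Fin n × Fin n with q.1 < q.2 ∧ q.1 ≠ l ∧ q.2 ≠ l,
    MonoidAlgebra.single (Equiv.swap q.1 q.2) (1 : ℂ)

end SymmetricGroup

-- Labellings that fit the diagrams of the generators

namespace PartitionDiagram

variable {n r m : ℕ}

-- The recursively defined elements have simple closed actions on a basis tensor with labels `b 0, b
-- 1, …`. Write `(x y)` for a transposition of labels and `l = b m`. Then `L_{m+1}` is the sum over
-- `j` of `(j l)` applied to the first `m + 1` factors, and `L_{m+1/2}` is the sum over `j` of the
-- identity minus `(j l)` applied to the first `m` factors. Each of `σ_{m+2}` and `σ_{m+1+1/2}`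
-- applies the single transposition `(b m b (m+1))`, to the first `m + 2` and to the first `m`
-- factors respectively.
--
-- These formulas follow by induction. One step of a recursion permutes the labels in an initial
-- segment and otherwise touches at most the next three places, so `spliceTensor` reduces it to a
-- check on three labels `x, y, w`. The conjugated term is right except where the transposition also
-- moves a label that conjugation carried past it; the other terms repair exactly those cases.
--
-- Summing the `L`'s then telescopes. Let `κ` act on the first `m` factors only, and split its
-- transpositions by whether they move `l`. Adding `L_{m+1/2}` replaces those moving `l` by `n - 1`
-- copies of the identity. What remains fixes `l`, so it may equally be applied to `m + 1` factors.
-- Adding `L_{m+1}` restores the transpositions moving `l`, now on `m + 1` factors, together with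
-- one further identity. Each full step thus contributes `n` identities, starting from `binom(n, 2)`
-- identities on the empty prefix.

theorem fits_sDiagram_iff (hm : m + 1 < r) (b : ℕ → Fin n) (j : Fin r → Fin n) :
    Fits (sDiagram r (m + 1)) j (fun a => b a) ↔ j = fun a : Fin r => b (Equiv.swap m (m + 1) a) := by
  have hs : ∀ a : ℕ, Equiv.swap (m + 1) (m + 1 + 1) (a + 1) = Equiv.swap m (m + 1) a + 1 := by
    intro a
    simp only [Equiv.swap_apply_def]
    grind
  constructor
  · intro h
    funext a
    have ha : Equiv.swap m (m + 1) (a : ℕ) < r := by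
      have := a.2
      simp only [Equiv.swap_apply_def]
      grind
    exact h (x := Sum.inl a) (y := Sum.inr ⟨_, ha⟩) (hs a)
  · rintro rfl x y hxy
    -- The labelling factors through the function whose kernel is the diagram; `- 1` undoes the
    -- numbering of vertices from 1.
    have key : ∀ x : Fin r ⊕ Fin r,
        Sum.elim (fun a : Fin r => b (Equiv.swap m (m + 1) a)) (fun a : Fin r => b a) x =
          b (Sum.elim (fun a : Fin r => Equiv.swap (m + 1) (m + 1 + 1) (a.val + 1))
            (fun a : Fin r => a.val + 1) x - 1) := by
      rintro (a | a) <;> simp [hs]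
    rw [Setoid.ker_def] at hxy ⊢
    rw [key, key, hxy]

theorem fits_pHalfDiagram_iff (hm : m + 1 < r) (b : ℕ → Fin n) (j : Fin r → Fin n) :
    Fits (pHalfDiagram r (m + 1)) j (fun a => b a) ↔ j = (fun a : Fin r => b a) ∧ b m = b (m + 1) := by
  constructor
  · intro h
    refine ⟨?_, ?_⟩
    · funext a
      exact h (x := Sum.inl a) (y := Sum.inr a) rfl
    · exact h (x := Sum.inr ⟨m, by omega⟩) (y := Sum.inr ⟨m + 1, hm⟩) (by
        rw [Setoid.ker_def]; simp)
  · rintro ⟨rfl, hb⟩ x y hxy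
    have key : ∀ x : Fin r ⊕ Fin r, Sum.elim (fun a : Fin r => b a) (fun a : Fin r => b a) x =
        b (Sum.elim id id x : Fin r) := by
      rintro (a | a) <;> rfl
    rw [Setoid.ker_def] at hxy ⊢
    rw [key, key]
    generalize (Sum.elim id id x : Fin r) = x at *
    generalize (Sum.elim id id y : Fin r) = y at *
    grind

theorem fits_pDiagram_iff (b : ℕ → Fin n) (j : Fin r → Fin n) :
    Fits (pDiagram r (m + 1)) j (fun a => b a) ↔ ∀ a : Fin r, a.val ≠ m → j a = b a := by
  constructor
  · intro h a ha
    exact h (x := Sum.inl a) (y := Sum.inr a) (by rw [Setoid.ker_def]; simp [ha])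
  · rintro h x y hxy
    rw [Setoid.ker_def] at hxy ⊢
    rcases x with x | x <;> rcases y with y | y <;>
      simp only [Sum.elim_inl, Sum.elim_inr, Prod.mk.injEq, Nat.add_right_cancel_iff,
        ← Fin.ext_iff] at hxy ⊢
    · rw [hxy.1]
    · rw [← hxy.1]
      exact h x (by simpa using hxy.2)
    · rw [hxy.1]
      exact (h y (by simpa using hxy.2.symm)).symm
    · rw [hxy.1]

end PartitionDiagram

-- Generators acting on basis tensors

namespace PartitionAlgebra

variable {n r m : ℕ} {V : Type*} [AddCommGroup V] [Module ℂ V] (v : Module.Basis (Fin n) ℂ V)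

/-- The basis tensor of `V^{⊗ r}` given by the first `r` terms of a sequence of labels. -/
noncomputable def basisTensor (r : ℕ) (b : ℕ → Fin n) : ⨂[ℂ] _ : Fin r, V :=
  ⨂ₜ[ℂ] a : Fin r, v (b a)

theorem tensorAction_ofDiagram (d : PartitionDiagram r) (b : ℕ → Fin n) :
    tensorAction v (ofDiagram (n : ℂ) d) (basisTensor v r b) =
      ∑ j : Fin r → Fin n, (entry d j (fun a => b a) : ℂ) • ⨂ₜ[ℂ] a, v (j a) := by
  rw [← diagramAction_tprod]
  exact LinearMap.congr_fun (extend_ofDiagram _ d) _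

theorem tensorAction_s (hm : m + 1 < r) (b : ℕ → Fin n) :
    tensorAction v (s (n : ℂ) r (m + 1)) (basisTensor v r b) =
      basisTensor v r (fun a => b (Equiv.swap m (m + 1) a)) := by
  classical
  rw [s, tensorAction_ofDiagram]
  simp [entry, fits_sDiagram_iff hm, basisTensor]

theorem tensorAction_pHalf (hm : m + 1 < r) (b : ℕ → Fin n) :
    tensorAction v (pHalf (n : ℂ) r (m + 1)) (basisTensor v r b) =
      if b m = b (m + 1) then basisTensor v r b else 0 := by
  classical
  rw [pHalf, tensorAction_ofDiagram]
  simp [entry, fits_pHalfDiagram_iff hm, basisTensor, ite_and]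

theorem tensorAction_p (hm : m < r) (b : ℕ → Fin n) :
    tensorAction v (p (n : ℂ) r (m + 1)) (basisTensor v r b) =
      ∑ c, basisTensor v r (Function.update b m c) := by
  classical
  simp only [p, tensorAction_ofDiagram, entry, fits_pDiagram_iff, Nat.cast_ite, Nat.cast_one,
    Nat.cast_zero, ite_smul, one_smul, zero_smul, ← Finset.sum_filter]
  symm
  -- A fitting labelling is determined by its value at the one free vertex.
  refine Finset.sum_bij' (fun c _ a => Function.update b m c a) (fun j _ => j ⟨m, hm⟩)
    ?_ ?_ ?_ ?_ ?_
  · intro c _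
    simp only [Finset.mem_filter, Finset.mem_univ, true_and]
    intro a ha
    simp [ha]
  · simp
  · simp
  · intro j hj
    simp only [Finset.mem_filter, Finset.mem_univ, true_and] at hj
    funext a
    by_cases ha : a.val = m
    · subst ha; simp
    · simp [ha, hj a ha]
  · intro c _
    rfl

end PartitionAlgebra

-- Three-place local form of the action

/-- Apply the permutation `π` to the first `m` terms of a sequence. -/
def permPrefix {n : ℕ} (m : ℕ) (π : Equiv.Perm (Fin n)) (b : ℕ → Fin n) : ℕ → Fin n :=
  fun a => if a < m then π (b a) else b a

/-- The sequence `b` with `π` applied to its first `m` terms and the three terms that follow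
replaced by `x`, `y`, `w`. -/
def spliceSeq {n : ℕ} (b : ℕ → Fin n) (m : ℕ) (π : Equiv.Perm (Fin n)) (x y w : Fin n) :
    ℕ → Fin n :=
  fun a => if a < m then π (b a) else if a = m then x else if a = m + 1 then y
    else if a = m + 2 then w else b a

namespace PartitionAlgebra

variable {n r m : ℕ} {V : Type*} [AddCommGroup V] [Module ℂ V] (v : Module.Basis (Fin n) ℂ V)

/-- The basis tensor given by a spliced sequence. -/
noncomputable abbrev spliceTensor (r : ℕ) (b : ℕ → Fin n) (m : ℕ) (π : Equiv.Perm (Fin n))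
    (x y w : Fin n) : ⨂[ℂ] _ : Fin r, V := basisTensor v r (spliceSeq b m π x y w)

variable (b : ℕ → Fin n) (π : Equiv.Perm (Fin n)) (x y w : Fin n)

/-- Entry point for the inductive steps: any basis tensor becomes a spliced one, after which the
three labels can be generalized. -/
theorem spliceSeq_self : spliceSeq b m 1 (b m) (b (m + 1)) (b (m + 2)) = b := by
  funext a
  simp only [spliceSeq, Equiv.Perm.coe_one, id]
  grind

theorem s_spliceTensor (hm : m + 1 < r) :
    tensorAction v (s (n : ℂ) r (m + 1)) (spliceTensor v r b m π x y w) =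
      spliceTensor v r b m π y x w := by
  rw [spliceTensor, tensorAction_s v hm]
  congr 1
  funext a
  simp only [spliceSeq, Equiv.swap_apply_def]
  grind

theorem s_succ_spliceTensor (hm : m + 2 < r) :
    tensorAction v (s (n : ℂ) r (m + 2)) (spliceTensor v r b m π x y w) =
      spliceTensor v r b m π x w y := by
  rw [spliceTensor, tensorAction_s v hm]
  congr 1
  funext a
  simp only [spliceSeq, Equiv.swap_apply_def]
  grind

theorem pHalf_spliceTensor (hm : m + 1 < r) :
    tensorAction v (pHalf (n : ℂ) r (m + 1)) (spliceTensor v r b m π x y w) =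
      if x = y then spliceTensor v r b m π x y w else 0 := by
  rw [spliceTensor, tensorAction_pHalf v hm]
  simp [spliceSeq]

theorem pHalf_succ_spliceTensor (hm : m + 2 < r) :
    tensorAction v (pHalf (n : ℂ) r (m + 2)) (spliceTensor v r b m π x y w) =
      if y = w then spliceTensor v r b m π x y w else 0 := by
  rw [spliceTensor, tensorAction_pHalf v hm]
  congr 1
  simp [spliceSeq, show ¬ m + 1 + 1 < m by omega, show m + 1 + 1 ≠ m by omega]

theorem p_spliceTensor (hm : m < r) :
    tensorAction v (p (n : ℂ) r (m + 1)) (spliceTensor v r b m π x y w) =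
      ∑ c, spliceTensor v r b m π c y w := by
  rw [spliceTensor, tensorAction_p v hm]
  refine Finset.sum_congr rfl fun c _ => ?_
  congr 1
  funext a
  simp only [spliceSeq, Function.update_apply]
  grind

theorem p_succ_spliceTensor (hm : m + 1 < r) :
    tensorAction v (p (n : ℂ) r (m + 2)) (spliceTensor v r b m π x y w) =
      ∑ c, spliceTensor v r b m π x c w := by
  rw [spliceTensor, tensorAction_p v hm]
  refine Finset.sum_congr rfl fun c _ => ?_
  congr 1
  funext a
  simp only [spliceSeq, Function.update_apply]
  grind

theorem permPrefix_spliceSeq (ρ : Equiv.Perm (Fin n)) :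
    permPrefix m ρ (spliceSeq b m π x y w) = spliceSeq b m (ρ * π) x y w := by
  funext a
  simp only [spliceSeq, permPrefix, Equiv.Perm.mul_apply]
  grind

theorem permPrefix_succ_spliceSeq (ρ : Equiv.Perm (Fin n)) :
    permPrefix (m + 1) ρ (spliceSeq b m π x y w) = spliceSeq b m (ρ * π) (ρ x) y w := by
  funext a
  simp only [spliceSeq, permPrefix, Equiv.Perm.mul_apply]
  grind

theorem permPrefix_add_two_spliceSeq (ρ : Equiv.Perm (Fin n)) :
    permPrefix (m + 2) ρ (spliceSeq b m π x y w) = spliceSeq b m (ρ * π) (ρ x) (ρ y) w := by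
  funext a
  simp only [spliceSeq, permPrefix, Equiv.Perm.mul_apply]
  grind

theorem permPrefix_add_three_spliceSeq (ρ : Equiv.Perm (Fin n)) :
    permPrefix (m + 3) ρ (spliceSeq b m π x y w) = spliceSeq b m (ρ * π) (ρ x) (ρ y) (ρ w) := by
  funext a
  simp only [spliceSeq, permPrefix, Equiv.Perm.mul_apply]
  grind

@[simp] theorem spliceSeq_apply_zero : spliceSeq b m π x y w m = x := by simp [spliceSeq]
@[simp] theorem spliceSeq_apply_one : spliceSeq b m π x y w (m + 1) = y := by simp [spliceSeq]
@[simp] theorem spliceSeq_apply_two : spliceSeq b m π x y w (m + 2) = w := by simp [spliceSeq]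

-- Closed formulas for the recursive elements

/-- `σ_{m+2}` permutes the labels of the first `m + 2` factors by the transposition of the
labels in places `m + 1` and `m + 2`. -/
def SigmaFormula (r m : ℕ) : Prop := ∀ b : ℕ → Fin n,
  tensorAction v (sigma (n : ℂ) r (m + 2)) (basisTensor v r b) =
    basisTensor v r (permPrefix (m + 2) (Equiv.swap (b m) (b (m + 1))) b)

/-- `L_{m+1}` sums over all labels `j` the tensors obtained by transposing `j` and the label in
place `m + 1` in the first `m + 1` factors. -/
def LFormula (r m : ℕ) : Prop := ∀ b : ℕ → Fin n,
  tensorAction v (L (n : ℂ) r (m + 1)) (basisTensor v r b) =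
    ∑ j, basisTensor v r (permPrefix (m + 1) (Equiv.swap j (b m)) b)

/-- `σ_{m+1+1/2}` permutes the labels of the first `m` factors by the transposition of the labels
in places `m + 1` and `m + 2`. -/
def SigmaHalfFormula (r m : ℕ) : Prop := ∀ b : ℕ → Fin n,
  tensorAction v (sigmaHalf (n : ℂ) r (m + 1)) (basisTensor v r b) =
    basisTensor v r (permPrefix m (Equiv.swap (b m) (b (m + 1))) b)

/-- `L_{m+1/2}` sums, over all labels `j`, the differences between a basis tensor and the tensor
obtained by transposing `j` and the label in place `m + 1` in the first `m` factors. -/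
def LHalfFormula (r m : ℕ) : Prop := ∀ b : ℕ → Fin n,
  tensorAction v (LHalf (n : ℂ) r m) (basisTensor v r b) =
    ∑ j, (basisTensor v r b - basisTensor v r (permPrefix m (Equiv.swap j (b m)) b))

variable {v}

theorem LFormula.spliceTensor (h : LFormula v r m) :
    tensorAction v (L (n : ℂ) r (m + 1)) (spliceTensor v r b m π x y w) =
      ∑ j, spliceTensor v r b m (Equiv.swap j x * π) j y w := by
  rw [PartitionAlgebra.spliceTensor, h]
  simp [permPrefix_succ_spliceSeq]

theorem SigmaFormula.spliceTensor (h : SigmaFormula v r m) :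
    tensorAction v (sigma (n : ℂ) r (m + 2)) (spliceTensor v r b m π x y w) =
      spliceTensor v r b m (Equiv.swap x y * π) y x w := by
  rw [PartitionAlgebra.spliceTensor, h]
  simp [permPrefix_add_two_spliceSeq]

theorem SigmaHalfFormula.spliceTensor (h : SigmaHalfFormula v r m) :
    tensorAction v (sigmaHalf (n : ℂ) r (m + 1)) (spliceTensor v r b m π x y w) =
      spliceTensor v r b m (Equiv.swap x y * π) x y w := by
  rw [PartitionAlgebra.spliceTensor, h]
  simp [permPrefix_spliceSeq]

theorem LHalfFormula.spliceTensor (h : LHalfFormula v r m) :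
    tensorAction v (LHalf (n : ℂ) r m) (spliceTensor v r b m π x y w) =
      ∑ j, (spliceTensor v r b m π x y w -
        spliceTensor v r b m (Equiv.swap j x * π) x y w) := by
  rw [PartitionAlgebra.spliceTensor, h]
  simp [permPrefix_spliceSeq]

end PartitionAlgebra

/-- Used when the conjugated term of a recursion gives every summand of the target but one. -/
theorem Fintype.sum_eq_sum_add_sub {ι M : Type*} [Fintype ι] [AddCommGroup M]
    {f g : ι → M} (i : ι) (h : ∀ j ≠ i, g j = f j) : ∑ j, g j = ∑ j, f j + (g i - f i) := by
  rw [← sub_eq_iff_eq_add', ← Finset.sum_sub_distrib]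
  exact Fintype.sum_eq_single i fun j hj => by rw [h j hj, sub_self]

-- Induction for the closed formulas

namespace PartitionAlgebra

variable {n r m : ℕ} {V : Type*} [AddCommGroup V] [Module ℂ V] {v : Module.Basis (Fin n) ℂ V}

theorem map_ite_zero {M N : Type*} [AddCommGroup M] [Module ℂ M] [AddCommGroup N] [Module ℂ N]
    (f : M →ₗ[ℂ] N) (P : Prop) [Decidable P] (t : M) :
    f (if P then t else 0) = if P then f t else 0 := by
  split_ifs <;> simp

theorem SigmaFormula.succ (hm : m + 2 < r) (hs : SigmaFormula v r m) (hL : LFormula v r m) :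
    SigmaFormula v r (m + 1) := by
  intro b
  have hm' : m + 1 < r := by omega
  rw [← spliceSeq_self (m := m) b, show m + 1 + 2 = m + 3 from rfl, sigma,
    permPrefix_add_three_spliceSeq, show m + 1 + 1 = m + 2 from rfl, spliceSeq_apply_one,
    spliceSeq_apply_two]
  generalize b m = x, b (m + 1) = y, b (m + 2) = w
  -- The conjugated term gives `(y w)` on the prefix with labels `x, w, y`, which is right unless
  -- `(y w)` moves `x`. If exactly one of `x = y`, `x = w` holds, one negative term cancels it and
  -- one positive term supplies the target. If all three labels agree, every term is the identity
  -- and `1 + 1 + 1 - 1 - 1 = 1`.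
  by_cases hxy : x = y <;> by_cases hyw : y = w <;> by_cases hxw : x = w <;>
  simp_all [map_ite_zero, s_spliceTensor, s_succ_spliceTensor, pHalf_spliceTensor,
    p_succ_spliceTensor, pHalf_succ_spliceTensor, hL.spliceTensor, hs.spliceTensor,
    Equiv.swap_comm, Equiv.swap_apply_of_ne_of_ne, eq_comm]

theorem LFormula.succ (hm : m + 1 < r) (hL : LFormula v r m) (hs : SigmaFormula v r m) :
    LFormula v r (m + 1) := by
  intro b
  rw [← spliceSeq_self (m := m) b, show m + 1 + 1 = m + 2 from rfl, L]
  simp only [permPrefix_add_two_spliceSeq, spliceSeq_apply_one]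
  generalize b m = x, b (m + 1) = y, b (m + 2) = w
  -- For equal labels, the term containing `p_{m+2}` is the whole target: its free label is forced
  -- to equal `j`. The remaining four terms cancel in pairs.
  rcases eq_or_ne x y with rfl | hxy
  · simp [s_spliceTensor, pHalf_spliceTensor, p_succ_spliceTensor, hm, hL.spliceTensor,
      hs.spliceTensor]
    abel
  -- For distinct labels, `s L s` gives `f`, wrong only at `j = x`, where `(j y)` should also move
  -- `x`. The term `- p_{m+3/2} L s` removes that summand and `σ` inserts the correct one.
  · rw [Fintype.sum_eq_sum_add_sub (f := fun j => PartitionAlgebra.spliceTensor v r b m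
      (Equiv.swap j y * 1) x j w) x]
    · simp [hxy, s_spliceTensor, pHalf_spliceTensor, hm, hL.spliceTensor, hs.spliceTensor]
      abel
    · intro j hj
      rw [Equiv.swap_apply_of_ne_of_ne hj.symm hxy, Equiv.swap_apply_right]

theorem SigmaHalfFormula.succ (hm : m + 2 < r) (hs : SigmaHalfFormula v r m)
    (hL : LFormula v r m) : SigmaHalfFormula v r (m + 1) := by
  intro b
  have hm' : m + 1 < r := by omega
  rw [← spliceSeq_self (m := m) b, show m + 1 + 1 = m + 2 from rfl, sigmaHalf,
    permPrefix_succ_spliceSeq, spliceSeq_apply_one, spliceSeq_apply_two]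
  generalize b m = x, b (m + 1) = y, b (m + 2) = w
  -- Same cancellation as for `σ_{m+3}`, with the labels `y, w` left in place.
  by_cases hxy : x = y <;> by_cases hyw : y = w <;> by_cases hxw : x = w <;>
  simp_all [map_ite_zero, s_spliceTensor, s_succ_spliceTensor, pHalf_spliceTensor,
    p_succ_spliceTensor, pHalf_succ_spliceTensor, hL.spliceTensor, hs.spliceTensor,
    Equiv.swap_comm, Equiv.swap_apply_of_ne_of_ne, eq_comm]

theorem LHalfFormula.succ (hm : m + 1 < r) (hh : LHalfFormula v r m) (hL : LFormula v r m)
    (hs : SigmaHalfFormula v r m) : LHalfFormula v r (m + 1) := by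
  intro b
  have hm' : m < r := by omega
  rw [← spliceSeq_self (m := m) b, LHalf]
  simp only [permPrefix_succ_spliceSeq, spliceSeq_apply_one]
  generalize b m = x, b (m + 1) = y, b (m + 2) = w
  -- For equal labels, `- L p_{m+3/2}` supplies the transposition part of the target, the term with
  -- `p_{m+1}` cancels that of the conjugated `L_{m+1/2}`, and `σ` cancels `- p_{m+3/2} L`.
  rcases eq_or_ne x y with rfl | hxy
  · simp [s_spliceTensor, pHalf_spliceTensor, p_spliceTensor, Equiv.swap_comm x,
      hm, hm', hL.spliceTensor, hs.spliceTensor, hh.spliceTensor]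
    abel
  -- For distinct labels, again only `j = x` is wrong: `σ` cancels its summand and `- p_{m+3/2} L`
  -- puts in the right one.
  · rw [Finset.sum_sub_distrib, Fintype.sum_eq_sum_add_sub 
      (g := fun j => PartitionAlgebra.spliceTensor v r b m (Equiv.swap j y * 1)
        (Equiv.swap j y x) y w)
      (f := fun j => PartitionAlgebra.spliceTensor v r b m (Equiv.swap j y * 1) x y w) x]
    · simp [hxy, s_spliceTensor, pHalf_spliceTensor, Equiv.swap_comm y x, hm, hL.spliceTensor,
        hs.spliceTensor, hh.spliceTensor]
      abel
    · intro j hj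
      rw [Equiv.swap_apply_of_ne_of_ne hj.symm hxy]

theorem permPrefix_zero (ρ : Equiv.Perm (Fin n)) (b : ℕ → Fin n) : permPrefix 0 ρ b = b := by
  funext a
  simp [permPrefix]

theorem lFormula_zero (hr : 0 < r) : LFormula v r 0 := by
  intro b
  rw [zero_add, L, tensorAction_p v hr]
  -- On a prefix of length one, transposing `c` with the first label just replaces that label by
  -- `c`.
  refine Finset.sum_congr rfl fun c _ => ?_
  congr 1
  funext a
  rcases Nat.eq_zero_or_pos a with rfl | ha <;> simp [permPrefix, *]
  grind

theorem sigmaFormula_zero (hr : 1 < r) : SigmaFormula v r 0 := by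
  intro b
  rw [zero_add, sigma, tensorAction_s v (m := 0) hr]
  congr 1
  funext a
  simp only [permPrefix, Equiv.swap_apply_def]
  grind

/-- The induction is joint because each of the two recursions uses both families. The bound for
`σ_{m+2}` is one stricter since it involves place `m + 2`. -/
theorem lFormula_and_sigmaFormula (m : ℕ) :
    (m < r → LFormula v r m) ∧ (m + 1 < r → SigmaFormula v r m) := by
  induction m with
  | zero => exact ⟨lFormula_zero, sigmaFormula_zero⟩
  | succ m ih =>
    exact ⟨fun h => (ih.1 (by omega)).succ h (ih.2 h),
      fun h => (ih.2 (by omega)).succ h (ih.1 (by omega))⟩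

theorem lFormula (hm : m < r) : LFormula v r m := (lFormula_and_sigmaFormula m).1 hm

theorem sigmaHalfFormula (hm : m + 1 < r) : SigmaHalfFormula v r m := by
  induction m with
  | zero =>
    intro b
    rw [zero_add, sigmaHalf, permPrefix_zero, map_one, Module.End.one_apply]
  | succ m ih => exact (ih (by omega)).succ hm (lFormula (by omega))

theorem lHalfFormula (hm : m < r) : LHalfFormula v r m := by
  induction m with
  | zero =>
    intro b
    simp [LHalf, permPrefix_zero]
  | succ m ih => exact (ih (by omega)).succ hm (lFormula (by omega)) (sigmaHalfFormula hm)

end PartitionAlgebra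

-- Sums over unordered pairs

theorem Fin.card_filter_fst_lt_snd (n : ℕ) :
    (Finset.univ.filter fun q : Fin n × Fin n => q.1 < q.2).card = n.choose 2 := by
  rw [Finset.card_filter, Fintype.sum_prod_type_right]
  have h (j : Fin n) : ∑ i : Fin n, (if i < j then 1 else 0) = (j : ℕ) := by
    rw [← Finset.card_filter, Finset.filter_gt_eq_Iio, Fin.card_Iio]
  simp_rw [h]
  rw [Fin.sum_univ_eq_sum_range (fun j => j) n, Finset.sum_range_id, Nat.choose_two_right]

/-- A sum of a symmetric function over unordered pairs, split according to whether the pair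
contains `l`. -/
theorem Fin.sum_pairs_eq_add {n : ℕ} {M : Type*} [AddCommMonoid M] (g : Fin n → Fin n → M)
    (hg : ∀ x y, g x y = g y x) (l : Fin n) :
    ∑ q : Fin n × Fin n with q.1 < q.2, g q.1 q.2 =
      ∑ q : Fin n × Fin n with q.1 < q.2 ∧ q.1 ≠ l ∧ q.2 ≠ l, g q.1 q.2 +
        ∑ j with j ≠ l, g j l := by
  rw [← Finset.sum_filter_add_sum_filter_not _ (fun q : Fin n × Fin n => q.1 ≠ l ∧ q.2 ≠ l),
    Finset.filter_filter]
  congr 1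
  -- A pair containing `l` corresponds to its other element.
  refine Finset.sum_bij' (fun q _ => if q.1 = l then q.2 else q.1)
    (fun j _ => if j < l then (j, l) else (l, j)) ?_ ?_ ?_ ?_ ?_
  · intro q hq
    simp only [Finset.mem_filter, Finset.mem_univ, true_and] at hq ⊢
    grind
  · intro j hj
    simp only [Finset.mem_filter, Finset.mem_univ, true_and] at hj ⊢
    grind
  · rintro ⟨x, y⟩ hq
    simp only [Finset.mem_filter, Finset.mem_univ, true_and] at hq ⊢
    grind
  · intro j hj
    simp only [Finset.mem_filter, Finset.mem_univ, true_and] at hj ⊢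
    grind
  · rintro ⟨x, y⟩ hq
    simp only [Finset.mem_filter, Finset.mem_univ, true_and] at hq ⊢
    grind

-- Telescoping the sums of Jucys–Murphy elements

namespace PartitionAlgebra

variable {n r m : ℕ} {V : Type*} [AddCommGroup V] [Module ℂ V] (v : Module.Basis (Fin n) ℂ V)

theorem permPrefix_succ_of_apply_eq {ρ : Equiv.Perm (Fin n)} {b : ℕ → Fin n}
    (h : ρ (b m) = b m) : permPrefix (m + 1) ρ b = permPrefix m ρ b := by
  funext a
  simp only [permPrefix]
  grind

theorem permPrefix_one (b : ℕ → Fin n) : permPrefix m 1 b = b := by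
  funext a
  simp [permPrefix]

/-- The summand `j = l` is the trivial transposition; it accounts for the `+ 1` in the half-integer
constant. -/
theorem sum_permPrefix_swap (l : Fin n) (b : ℕ → Fin n) :
    ∑ j, basisTensor v r (permPrefix m (Equiv.swap j l) b) =
      ∑ j with j ≠ l, basisTensor v r (permPrefix m (Equiv.swap j l) b) + basisTensor v r b := by
  rw [← Finset.sum_filter_add_sum_filter_not Finset.univ (fun j => j ≠ l)]
  simp [Finset.filter_eq', ← Equiv.Perm.one_def, permPrefix_one]

/-- The transpositions moving `b m` cancel against `L_{m+1/2}`, leaving `n - 1` identities. With the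
formula for `z_m` as a hypothesis, this serves as the half step inside the induction that proves
that formula. -/
theorem zHalf_basisTensor_of_z {b : ℕ → Fin n} (hm : m < r)
    (hz : tensorAction v (z (n : ℂ) r m) (basisTensor v r b) =
      ∑ q : Fin n × Fin n with q.1 < q.2,
        basisTensor v r (permPrefix m (Equiv.swap q.1 q.2) b) -
          ((n.choose 2 : ℂ) - (m : ℂ) * (n : ℂ)) • basisTensor v r b) :
    tensorAction v (zHalf (n : ℂ) r m) (basisTensor v r b) =
      ∑ q : Fin n × Fin n with q.1 < q.2 ∧ q.1 ≠ b m ∧ q.2 ≠ b m,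
        basisTensor v r (permPrefix m (Equiv.swap q.1 q.2) b) -
          ((n.choose 2 : ℂ) - ((m : ℂ) + 1) * (n : ℂ) + 1) • basisTensor v r b := by
  rw [zHalf, map_add, LinearMap.add_apply, hz, lHalfFormula hm,
    Fin.sum_pairs_eq_add (fun x y => basisTensor v r (permPrefix m (Equiv.swap x y) b))
      (fun x y => by rw [Equiv.swap_comm]) (b m), Finset.sum_sub_distrib,
    sum_permPrefix_swap, Finset.sum_const, Finset.card_univ, Fintype.card_fin,
    ← Nat.cast_smul_eq_nsmul ℂ]
  module

theorem z_basisTensor (hm : m ≤ r) (b : ℕ → Fin n) :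
    tensorAction v (z (n : ℂ) r m) (basisTensor v r b) =
      ∑ q : Fin n × Fin n with q.1 < q.2,
        basisTensor v r (permPrefix m (Equiv.swap q.1 q.2) b) -
          ((n.choose 2 : ℂ) - (m : ℂ) * (n : ℂ)) • basisTensor v r b := by
  induction m with
  | zero =>
    simp [z, permPrefix_zero, Fin.card_filter_fst_lt_snd, ← Nat.cast_smul_eq_nsmul ℂ]
  | succ m ih =>
    have hz : z (n : ℂ) r (m + 1) = zHalf (n : ℂ) r m + L (n : ℂ) r (m + 1) := by
      rw [zHalf, z, Finset.sum_range_succ, z, add_assoc]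
    rw [hz, map_add, LinearMap.add_apply, zHalf_basisTensor_of_z v hm (ih (by omega)),
      lFormula hm,
      Fin.sum_pairs_eq_add (fun x y => basisTensor v r (permPrefix (m + 1) (Equiv.swap x y) b))
        (fun x y => by rw [Equiv.swap_comm]) (b m),
      sum_permPrefix_swap,
      -- The remaining transpositions fix `b m`, so the prefix can be lengthened to `m + 1` at no
      -- cost.
      Finset.sum_congr rfl fun q hq => by
        simp only [Finset.mem_filter] at hq
        rw [← permPrefix_succ_of_apply_eq
          (Equiv.swap_apply_of_ne_of_ne hq.2.2.1.symm hq.2.2.2.symm)],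
      Nat.cast_add, Nat.cast_one]
    module

theorem zHalf_basisTensor (hm : m < r) (b : ℕ → Fin n) :
    tensorAction v (zHalf (n : ℂ) r m) (basisTensor v r b) =
      ∑ q : Fin n × Fin n with q.1 < q.2 ∧ q.1 ≠ b m ∧ q.2 ≠ b m,
        basisTensor v r (permPrefix (m + 1) (Equiv.swap q.1 q.2) b) -
          ((n.choose 2 : ℂ) - ((m : ℂ) + 1) * (n : ℂ) + 1) • basisTensor v r b := by
  rw [zHalf_basisTensor_of_z v hm (z_basisTensor v hm.le b)]
  congr 1
  refine Finset.sum_congr rfl fun q hq => ?_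
  simp only [Finset.mem_filter] at hq
  rw [permPrefix_succ_of_apply_eq (Equiv.swap_apply_of_ne_of_ne hq.2.2.1.symm hq.2.2.2.symm)]

-- Comparison with the class sums

theorem diagonalRep_basisTensor (w : Equiv.Perm (Fin n)) (b : ℕ → Fin n) :
    diagonalRep v r w (basisTensor v r b) = basisTensor v r (permPrefix r w b) := by
  simp [diagonalRep, basisTensor, permPrefix, permRep]

theorem kappa_basisTensor (b : ℕ → Fin n) :
    (diagonalRep v r).asAlgebraHom (kappa n) (basisTensor v r b) =
      ∑ q : Fin n × Fin n with q.1 < q.2,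
        basisTensor v r (permPrefix r (Equiv.swap q.1 q.2) b) := by
  simp [kappa, Representation.asAlgebraHom_single, diagonalRep_basisTensor]

theorem kappaFix_basisTensor (l : Fin n) (b : ℕ → Fin n) :
    (diagonalRep v r).asAlgebraHom (kappaFix n l) (basisTensor v r b) =
      ∑ q : Fin n × Fin n with q.1 < q.2 ∧ q.1 ≠ l ∧ q.2 ≠ l,
        basisTensor v r (permPrefix r (Equiv.swap q.1 q.2) b) := by
  simp [kappaFix, Representation.asAlgebraHom_single, diagonalRep_basisTensor]

end PartitionAlgebra

theorem mainTheorem12 {n r : ℕ} (hr : 1 ≤ r) {V : Type*} [AddCommGroup V] [Module ℂ V]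
    (v : Module.Basis (Fin n) ℂ V) (i : Fin r → Fin n) :
    PartitionAlgebra.tensorAction v (PartitionAlgebra.z (n : ℂ) r r) (⨂ₜ[ℂ] a, v (i a)) =
        (diagonalRep v r).asAlgebraHom (kappa n) (⨂ₜ[ℂ] a, v (i a))
          - ((n.choose 2 : ℂ) - (r : ℂ) * (n : ℂ)) • (⨂ₜ[ℂ] a, v (i a)) ∧
      (2 ≤ r →
        PartitionAlgebra.tensorAction v (PartitionAlgebra.zHalf (n : ℂ) r (r - 1))
            (⨂ₜ[ℂ] a, v (i a)) =
          (diagonalRep v r).asAlgebraHom (kappaFix n (i ⟨r - 1, Nat.sub_lt hr Nat.one_pos⟩))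
              (⨂ₜ[ℂ] a, v (i a))
            - ((n.choose 2 : ℂ) - (r : ℂ) * (n : ℂ) + 1) • (⨂ₜ[ℂ] a, v (i a))) := by

  obtain ⟨k, rfl⟩ : ∃ k, r = k + 1 := ⟨r - 1, by omega⟩
  -- Labels past place `r` never enter the tensor, so the default `i 0` is arbitrary.
  obtain ⟨b, hb⟩ : ∃ b : ℕ → Fin n, ∀ a : Fin (k + 1), b a = i a :=
    ⟨fun a => if h : a < k + 1 then i ⟨a, h⟩ else i 0, fun a => dif_pos a.2⟩
  have hi : (⨂ₜ[ℂ] a, v (i a)) = PartitionAlgebra.basisTensor v (k + 1) b := by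
    simp [PartitionAlgebra.basisTensor, hb]
  have hl : i ⟨k + 1 - 1, Nat.sub_lt hr Nat.one_pos⟩ = b k := (hb ⟨k, k.lt_succ_self⟩).symm
  rw [hi, hl, PartitionAlgebra.kappa_basisTensor, PartitionAlgebra.kappaFix_basisTensor]
  refine ⟨PartitionAlgebra.z_basisTensor v le_rfl b, fun _ => ?_⟩
  rw [Nat.add_sub_cancel, PartitionAlgebra.zHalf_basisTensor v k.lt_succ_self b, Nat.cast_add,
    Nat.cast_one]
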